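/- Let $c_0$ be the Banach space of complex null sequences with the supremum norm and let $B_{c_0}$ be its open unit ball. A set $A\subseteq B_{c_0}$ is called $B_{c_0}$-bounded if it is bounded and has positive distance to the boundary of $B_{c_0}$. Let $H_b(B_{c_0})$ be the space of holomorphic (i.e. everywhere Fréchet differentiable) functions $f:B_{c_0}\to\mathbb{C}$ that are bounded on every $B_{c_0}$-bounded set, endowed with the topology of uniform convergence on the $B_{c_0}$-bounded sets. Let $F:B_{c_0}\to B_{c_0}$, $F(x_1,x_2,\dots)=(0,x_1,x_2,\dots)$, be the forward shift, and let $C_F:H_b(B_{c_0})\to H_b(B_{c_0})$, $C_F(f)=f\circ F$, be the (well-defined, continuous, linear) composition operator. For a continuous linear operator $T$ on a locally convex Hausdorff space $E$ write $T_{[n]}=\frac1n\sum_{k=0}^{n-1}T^k$ for $n\ge 1$. The operator $T$ is mean ergodic if there is a continuous linear operator $L:E\to E$ with $T_{[n]}x\to Lx$ in $E$ for every $x\in E$, and uniformly mean ergodic if there is a continuous linear operator $L:E\to E$ such that $T_{[n]}\to L$ uniformly on the bounded subsets of $E$. **Proposition.** The operator $C_F:H_b(B_{c_0})\to H_b(B_{c_0})$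 is mean ergodic but not uniformly mean ergodic. -/

import Mathlib

open Filter Topology Bornology Metric
open scoped UniformConvergence ZeroAtInfty

/-! ### Mean ergodicity on topological vector spaces -/

section Ergodic

variable {E : Type*} [AddCommGroup E] [Module ℂ E] [TopologicalSpace E]
  [IsTopologicalAddGroup E] [ContinuousConstSMul ℂ E]

/-- The `n`-th Cesàro mean `(1/n) ∑_{k=0}^{n-1} T^k` (used for `n → ∞`; the value at `n = 0` is `0`). -/
noncomputable def cesaroMean (T : E →L[ℂ] E) (n : ℕ) : E →L[ℂ] E :=
  (n : ℂ)⁻¹ • ∑ k ∈ Finset.range n, T ^ k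

/-- `T` is mean ergodic: the Cesàro means converge pointwise to some `L ∈ L(E)`. -/
def IsMeanErgodic (T : E →L[ℂ] E) : Prop :=
  ∃ L : E →L[ℂ] E, ∀ x : E, Tendsto (fun n : ℕ => cesaroMean T n x) atTop (𝓝 (L x))

/-- `T` is uniformly mean ergodic: the Cesàro means converge in `L(E)` uniformly on the bounded
subsets of `E`. (Mathlib's topology on `E →L[ℂ] E` is the topology of bounded convergence.) -/
def IsUniformlyMeanErgodic (T : E →L[ℂ] E) : Prop :=
  ∃ L : E →L[ℂ] E, Tendsto (fun n : ℕ => cesaroMean T n) atTop (𝓝 L)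

end Ergodic

/-! ### Holomorphic functions of bounded type on the open unit ball -/

section Holomorphic

variable (X : Type*) [NormedAddCommGroup X] [NormedSpace ℂ X]

/-- The open unit ball of `X`. -/
abbrev UnitBall : Type _ := ball (0 : X) 1

variable {X}

/-- A subset `A` of `U` is `U`-bounded if it is bounded and has positive distance to the boundary
of `U` (no condition if the boundary is empty). -/
def IsRelBounded {U : Set X} (A : Set U) : Prop :=
  IsBounded (Subtype.val '' A) ∧
    ∃ δ : ℝ, 0 < δ ∧ ∀ a ∈ A, ∀ b ∈ frontier U, δ ≤ dist (a : X) b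

/-- `f : B_X → Y` is holomorphic, i.e. Fréchet differentiable over `ℂ` at every point of the (open)
unit ball. The extension `g` outside the ball is irrelevant. -/
def IsHolomorphic {Y : Type*} [NormedAddCommGroup Y] [NormedSpace ℂ Y] (f : UnitBall X → Y) :
    Prop :=
  ∃ g : X → Y, DifferentiableOn ℂ g (ball (0 : X) 1) ∧ ∀ x : UnitBall X, g x = f x

/-- A self-map of the unit ball is of bounded type if it maps `B_X`-bounded sets to `B_X`-bounded
sets. -/
def IsBoundedType (φ : UnitBall X → UnitBall X) : Prop :=
  ∀ A : Set (UnitBall X), IsRelBounded A → IsRelBounded (φ '' A)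

variable (X)

/-- The space `H_b(B_X)` of holomorphic functions `B_X → ℂ` that are bounded on the `B_X`-bounded
sets, with the (subspace) topology of uniform convergence on the `B_X`-bounded sets. -/
def Hb : Submodule ℂ (UnitBall X →ᵤ[{A : Set (UnitBall X) | IsRelBounded A}] ℂ) where
  carrier := {f | IsHolomorphic (UniformOnFun.toFun _ f) ∧
    ∀ A : Set (UnitBall X), IsRelBounded A → IsBounded (UniformOnFun.toFun _ f '' A)}
  zero_mem' := by
    refine ⟨⟨fun _ => 0, differentiableOn_const 0, fun _ => rfl⟩, fun A _ => ?_⟩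
    refine (isBounded_singleton (x := (0 : ℂ))).subset ?_
    rintro _ ⟨x, -, rfl⟩
    rfl
  add_mem' := by
    rintro f g ⟨⟨f', hf, hf'⟩, hfb⟩ ⟨⟨g', hg, hg'⟩, hgb⟩
    refine ⟨⟨fun x => f' x + g' x, hf.add hg, fun x => ?_⟩, fun A hA => ?_⟩
    · simp only [hf', hg']; rfl
    · refine ((hfb A hA).add (hgb A hA)).subset ?_
      rintro _ ⟨x, hx, rfl⟩
      exact Set.add_mem_add ⟨x, hx, rfl⟩ ⟨x, hx, rfl⟩
  smul_mem' := by
    rintro c f ⟨⟨f', hf, hf'⟩, hfb⟩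
    refine ⟨⟨fun x => c • f' x, hf.const_smul c, fun x => ?_⟩, fun A hA => ?_⟩
    · simp only [hf']; rfl
    · refine ((hfb A hA).smul₀ c).subset ?_
      rintro _ ⟨x, hx, rfl⟩
      exact Set.smul_mem_smul_set ⟨x, hx, rfl⟩

instance : ContinuousSMul ℂ (Hb X) :=
  UniformOnFun.continuousSMul_submodule_of_image_bounded ℂ (UnitBall X) ℂ (Hb X)
    fun _ hf A hA => (NormedSpace.isVonNBounded_iff ℂ).2 (hf.2 A hA)

variable {X}

/-- The composition operator `C_φ f = f ∘ φ` on `H_b(B_X)`, for a holomorphic self-map `φ` of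
bounded type. -/
noncomputable def compositionOperator (φ : UnitBall X → UnitBall X)
    (hφ : IsHolomorphic fun x => (φ x : X)) (hb : IsBoundedType φ) : Hb X →L[ℂ] Hb X where
  toFun f := ⟨UniformOnFun.ofFun _ (UniformOnFun.toFun _ f.1 ∘ φ), by
    obtain ⟨⟨f', hf, hf'⟩, hfb⟩ := f.2
    obtain ⟨φ', h, h'⟩ := hφ
    refine ⟨⟨f' ∘ φ', hf.comp h fun x hx => ?_, fun x => ?_⟩, fun A hA => ?_⟩
    · rw [h' ⟨x, hx⟩]; exact (φ ⟨x, hx⟩).2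
    · simp only [Function.comp_apply, h', hf']; rfl
    · have := hfb _ (hb A hA)
      rwa [Set.image_image] at this⟩
  map_add' _ _ := rfl
  map_smul' _ _ := rfl
  cont := by
    refine Continuous.subtype_mk ?_ _
    have h : Set.MapsTo (φ '' ·) {A : Set (UnitBall X) | IsRelBounded A}
        {A : Set (UnitBall X) | IsRelBounded A} := fun A hA => hb A hA
    exact (UniformOnFun.precomp_uniformContinuous (β := ℂ) h).continuous.comp
      continuous_subtype_val

theorem isRelBounded_unitBall_iff (A : Set (UnitBall X)) :
    IsRelBounded A ↔ ∃ r < 1, ∀ a ∈ A, ‖(a : X)‖ ≤ r := by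
  let _ : NormedSpace ℝ X := NormedSpace.restrictScalars ℝ ℂ X
  constructor
  · rintro ⟨-, δ, hδ, h⟩
    refine ⟨max (1 - δ) 0, by simp [hδ], fun a ha => ?_⟩
    by_cases ha0 : (a : X) = 0
    · simp [ha0]
    have hn : 0 < ‖(a : X)‖ := norm_pos_iff.2 ha0
    have ha1 : ‖(a : X)‖ < 1 := mem_ball_zero_iff.1 a.2
    have hs : ‖(‖(a : X)‖⁻¹ • (a : X))‖ = 1 := norm_smul_inv_norm (𝕜 := ℝ) ha0
    have := h a ha (‖(a : X)‖⁻¹ • (a : X)) (by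
      rw [frontier_ball (0 : X) one_ne_zero]; simpa using hs)
    have e : (a : X) - ‖(a : X)‖⁻¹ • (a : X) = (1 - ‖(a : X)‖⁻¹) • (a : X) := by
      rw [sub_smul, one_smul]
    rw [dist_eq_norm, e, norm_smul, Real.norm_eq_abs, abs_sub_comm,
      abs_of_nonneg (by rw [sub_nonneg]; exact (one_le_inv₀ hn).2 ha1.le), sub_mul,
      inv_mul_cancel₀ hn.ne'] at this
    exact le_max_of_le_left (by linarith)
  · rintro ⟨r, hr, h⟩
    refine ⟨isBounded_ball.subset (Set.image_subset_iff.2 fun a _ => a.2), 1 - r, by linarith,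
      fun a ha b hb => ?_⟩
    rw [frontier_ball (0 : X) one_ne_zero, mem_sphere_zero_iff_norm] at hb
    have := norm_sub_norm_le b (a : X)
    rw [dist_comm, dist_eq_norm]
    linarith [h a ha]

end Holomorphic

/-! ### The forward shift on `c₀` -/

/-- The Banach space `c₀` of complex null sequences, with the supremum norm. -/
abbrev CZero : Type := C₀(ℕ, ℂ)

/-- The underlying map of the forward shift, `(x₀, x₁, …) ↦ (0, x₀, x₁, …)`. -/
noncomputable def shiftFun (x : CZero) : CZero where
  toFun n := Nat.casesOn n 0 fun k => x k
  continuous_toFun := continuous_of_discreteTopology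
  zero_at_infty' := by
    have h := x.zero_at_infty'
    rw [cocompact_eq_cofinite, Nat.cofinite_eq_atTop] at h ⊢
    exact (tendsto_add_atTop_iff_nat 1).1 h

theorem norm_apply_le (x : CZero) (n : ℕ) : ‖x n‖ ≤ ‖x‖ :=
  x.toBCF.norm_coe_le_norm n

theorem norm_shiftFun_le (x : CZero) : ‖shiftFun x‖ ≤ ‖x‖ := by
  refine (BoundedContinuousFunction.norm_le (f := (shiftFun x).toBCF) (norm_nonneg x)).2 ?_
  rintro (_ | n)
  · change ‖(0 : ℂ)‖ ≤ ‖x‖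
    simp
  · exact norm_apply_le x n

/-- The forward shift `F(x₀, x₁, …) = (0, x₀, x₁, …)` as a continuous linear map on `c₀`. -/
noncomputable def forwardShift : CZero →L[ℂ] CZero :=
  LinearMap.mkContinuous
    { toFun := shiftFun
      map_add' := fun x y => by
        ext n
        cases n with
        | zero => exact (add_zero (0 : ℂ)).symm
        | succ n => rfl
      map_smul' := fun c x => by
        ext n
        cases n with
        | zero => exact (smul_zero c).symm
        | succ n => rfl }
    1 fun x => by simpa using norm_shiftFun_le x

/-- The forward shift as a self-map of the open unit ball of `c₀`. -/
noncomputable def forwardShiftBall (x : UnitBall CZero) : UnitBall CZero :=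
  ⟨forwardShift x, mem_ball_zero_iff.2
    ((norm_shiftFun_le x).trans_lt (mem_ball_zero_iff.1 x.2))⟩

theorem isHolomorphic_forwardShiftBall :
    IsHolomorphic fun x => (forwardShiftBall x : CZero) :=
  ⟨forwardShift, forwardShift.differentiable.differentiableOn, fun _ => rfl⟩

theorem isBoundedType_forwardShiftBall : IsBoundedType forwardShiftBall := by
  intro A hA
  obtain ⟨r, hr, h⟩ := (isRelBounded_unitBall_iff A).1 hA
  refine (isRelBounded_unitBall_iff _).2 ⟨r, hr, ?_⟩
  rintro _ ⟨a, ha, rfl⟩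
  exact (norm_shiftFun_le a).trans (h a ha)

/-!
The iterates of `C_F` converge to `f ↦ f 0` on every `f` in `H_b`, so the Cesàro means do as well;
the coordinate functionals, which form a bounded set, show that the convergence is not uniform on
bounded sets.

Since `F ^ k` maps the closed ball of radius `r` into its vectors that vanish in the first `k`
coordinates, convergence of `C_F ^ k f` means that `f x` is close to `f 0` for all `x` in the ball
with sufficiently late support (`exists_forall_support_norm_sub_lt`). If this failed, continuity of
`f` and truncation would give infinitely many disjointly supported vectors `v j` of norm at most `r`
with `|f (v j) - f 0|` bounded below. In the supremum norm, `∑ z j • v j` has norm at most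
`r * max |z j|`, so `z ↦ f (∑ z j • v j)` is holomorphic and bounded on a polydisc of radius `R > 1`,
by a bound `M` independent of the number of vectors. For such a function `g` one has
`|g 0|² + c ∑ j, |g (e j) - g 0|² ≤ M²` with a constant `c > 0` independent of the number of
variables (`norm_sq_add_sum_norm_sq_le`), which limits the number of the `v j`. That inequality
follows by adding one variable at a time from a one-variable one (`norm_sq_add_le_circleAverage`):
on the circle of radius `ρ > 1`, the mean of `|h|²` is `|h 0|²` plus the mean of `|h - h 0|²`, and
the latter dominates `|h 1 - h 0|²` by Cauchy's formula.

For the failure of uniform convergence, the mean of order `n + 1` of the `n`-th coordinate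
functional, at the point `(1/2, …, 1/2, 0, …)` with `n + 1` non-zero entries, equals `1/2`, whereas
the limit operator sends every coordinate functional to `0`
(`eval_cesaroMean_coord_halfBlock`, `Hb.isVonNBounded_range_coord`).
-/

/-! ### A quadratic inequality on polydiscs -/

theorem norm_circleAverage_le_circleAverage_norm {E : Type*} [NormedAddCommGroup E]
    [NormedSpace ℝ E] (f : ℂ → E) (c : ℂ) (R : ℝ) :
    ‖Real.circleAverage f c R‖ ≤ Real.circleAverage (fun z => ‖f z‖) c R := by
  rw [Real.circleAverage_def, Real.circleAverage_def, norm_smul, smul_eq_mul,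
    Real.norm_of_nonneg (by positivity)]
  gcongr
  exact intervalIntegral.norm_integral_le_integral_norm Real.two_pi_pos.le

/-- On a circle around `0`, the function `h - h 0` is orthogonal to the constants, by the mean value
property. -/
theorem circleAverage_norm_sq_eq_add {h : ℂ → ℂ} {ρ : ℝ} (hρ : 0 < ρ)
    (hh : DiffContOnCl ℂ h (ball 0 ρ)) :
    Real.circleAverage (fun z => ‖h z‖ ^ 2) 0 ρ =
      ‖h 0‖ ^ 2 + Real.circleAverage (fun z => ‖h z - h 0‖ ^ 2) 0 ρ := by
  have hcont : ContinuousOn h (sphere 0 ρ) := by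
    refine hh.continuousOn.mono ?_
    rw [closure_ball _ hρ.ne']
    exact sphere_subset_closedBall
  have hH : ContinuousOn (fun z => h z - h 0) (sphere 0 ρ) := hcont.sub continuousOn_const
  have hmul : ContinuousOn (fun z => starRingEnd ℂ (h 0) * (h z - h 0)) (sphere 0 ρ) :=
    continuousOn_const.mul hH
  have hzero : Real.circleAverage (fun z => starRingEnd ℂ (h 0) * (h z - h 0)) 0 ρ = 0 := by
    have := (((hh.sub (diffContOnCl_const (c := h 0))).const_smul (starRingEnd ℂ (h 0))))
    rw [← abs_of_pos hρ] at this
    refine this.circleAverage.trans ?_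
    simp
  have hre : Real.circleAverage (fun z => (starRingEnd ℂ (h 0) * (h z - h 0)).re) 0 ρ = 0 := by
    have := Complex.reCLM.circleAverage_comp_comm (hmul.circleIntegrable hρ.le)
    rw [hzero, map_zero] at this
    exact this
  have hpt : (fun z => ‖h z‖ ^ 2) = fun z =>
      (‖h 0‖ ^ 2 + ‖h z - h 0‖ ^ 2) +
        (2 : ℝ) • (starRingEnd ℂ (h 0) * (h z - h 0)).re := by
    funext z
    simp only [← Complex.normSq_eq_norm_sq, Complex.normSq_apply, Complex.mul_re, Complex.sub_re,
      Complex.sub_im, Complex.conj_re, Complex.conj_im, smul_eq_mul]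
    ring
  have i1 : CircleIntegrable (fun z => ‖h z - h 0‖ ^ 2) 0 ρ :=
    (hH.norm.pow 2).circleIntegrable hρ.le
  have i2 : CircleIntegrable (fun z => (starRingEnd ℂ (h 0) * (h z - h 0)).re) 0 ρ :=
    (Complex.continuous_re.comp_continuousOn hmul).circleIntegrable hρ.le
  have i0 : CircleIntegrable (fun _ : ℂ => ‖h 0‖ ^ 2) 0 ρ :=
    continuousOn_const.circleIntegrable hρ.le
  have i2' : CircleIntegrable (fun z => (2 : ℝ) • (starRingEnd ℂ (h 0) * (h z - h 0)).re) 0 ρ :=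
    i2.const_smul (a := (2 : ℝ))
  have i3 : CircleIntegrable (fun z => ‖h 0‖ ^ 2 + ‖h z - h 0‖ ^ 2) 0 ρ := i0.add i1
  rw [hpt, Real.circleAverage_fun_add i3 i2', Real.circleAverage_fun_add i0 i1,
    Real.circleAverage_fun_smul, hre, Real.circleAverage_const, smul_zero, add_zero]

/-- Point evaluations are bounded in the `L²` norm on the circle: Cauchy's formula for the
holomorphic function `h ^ 2`. -/
theorem norm_sq_le_circleAverage {h : ℂ → ℂ} {ρ : ℝ} (hh : DiffContOnCl ℂ h (ball 0 ρ))
    {w : ℂ} (hw : ‖w‖ < ρ) :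
    ‖h w‖ ^ 2 ≤ ρ / (ρ - ‖w‖) * Real.circleAverage (fun z => ‖h z‖ ^ 2) 0 ρ := by
  have hρ : 0 < ρ := (norm_nonneg w).trans_lt hw
  have hcont : ContinuousOn h (sphere 0 ρ) := by
    refine hh.continuousOn.mono ?_
    rw [closure_ball _ hρ.ne']
    exact sphere_subset_closedBall
  have h2 : DiffContOnCl ℂ (fun z => h z * h z) (ball 0 |ρ|) := by
    rw [abs_of_pos hρ]; exact hh.smul hh
  have hw' : w ∈ ball (0 : ℂ) |ρ| := by rw [abs_of_pos hρ]; simpa using hw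
  have hne : ∀ z ∈ sphere (0 : ℂ) ρ, z - w ≠ 0 := by
    intro z hz hzw
    rw [sub_eq_zero] at hzw
    rw [mem_sphere_zero_iff_norm, hzw] at hz
    exact hw.ne hz
  have key := h2.circleAverage_smul_div hw'
  calc ‖h w‖ ^ 2 = ‖h w * h w‖ := by rw [norm_mul, sq]
    _ = ‖Real.circleAverage (fun z => ((z - 0) / (z - w)) • (h z * h z)) 0 ρ‖ := by rw [key]
    _ ≤ Real.circleAverage (fun z => ‖((z - 0) / (z - w)) • (h z * h z)‖) 0 ρ :=
      norm_circleAverage_le_circleAverage_norm _ _ _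
    _ ≤ Real.circleAverage (fun z => (ρ / (ρ - ‖w‖)) • ‖h z‖ ^ 2) 0 ρ := by
      refine Real.circleAverage_mono ?_ ?_ ?_
      · refine ContinuousOn.circleIntegrable hρ.le (ContinuousOn.norm ?_)
        exact ((continuousOn_id.sub continuousOn_const).div
          (continuousOn_id.sub continuousOn_const) hne).smul (hcont.mul hcont)
      · exact ((hcont.norm.pow 2).const_smul (ρ / (ρ - ‖w‖))).circleIntegrable hρ.le
      · intro z hz
        rw [abs_of_pos hρ, mem_sphere_zero_iff_norm] at hz
        rw [sub_zero, norm_smul, norm_div, norm_mul, ← sq, hz, smul_eq_mul]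
        have : ρ - ‖w‖ ≤ ‖z - w‖ := by
          have := norm_sub_norm_le z w
          rwa [hz] at this
        have : 0 < ρ - ‖w‖ := sub_pos.2 hw
        gcongr
    _ = _ := by rw [Real.circleAverage_fun_smul, smul_eq_mul]

/-- The one-variable inequality behind the polydisc estimate: the quadratic mean of `h` over a circle
of radius `ρ > 1` controls the increment of `h` from `0` to `1` in addition to `h 0`. -/
theorem norm_sq_add_le_circleAverage {h : ℂ → ℂ} {ρ : ℝ} (hρ : 1 < ρ)
    (hh : DiffContOnCl ℂ h (ball 0 ρ)) :
    ‖h 0‖ ^ 2 + (ρ - 1) / ρ * ‖h 1 - h 0‖ ^ 2 ≤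
      Real.circleAverage (fun z => ‖h z‖ ^ 2) 0 ρ := by
  have h0 : 0 < ρ := one_pos.trans hρ
  have h1 : 0 < ρ - 1 := sub_pos.2 hρ
  have := norm_sq_le_circleAverage (hh.sub (diffContOnCl_const (c := h 0))) (w := 1)
    (by simpa using hρ)
  simp only [norm_one] at this
  rw [circleAverage_norm_sq_eq_add h0 hh]
  gcongr
  calc (ρ - 1) / ρ * ‖h 1 - h 0‖ ^ 2
      ≤ (ρ - 1) / ρ * (ρ / (ρ - 1) *
        Real.circleAverage (fun z => ‖h z - h 0‖ ^ 2) 0 ρ) := by gcongr; exact this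
    _ = _ := by rw [← mul_assoc, div_mul_div_comm, mul_comm (ρ - 1), div_self (by positivity),
        one_mul]

theorem circleAverage_add_mul_sum_le {ι : Type*} {a : ℂ → ℝ} {b : ι → ℂ → ℝ} {c M ρ : ℝ}
    (hρ : 0 < ρ) (s : Finset ι) (ha : CircleIntegrable a 0 ρ)
    (hb : ∀ j ∈ s, CircleIntegrable (b j) 0 ρ)
    (h : ∀ w ∈ sphere (0 : ℂ) ρ, a w + c * ∑ j ∈ s, b j w ≤ M) :
    Real.circleAverage a 0 ρ + c * ∑ j ∈ s, Real.circleAverage (b j) 0 ρ ≤ M := by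
  have hs : CircleIntegrable (fun w => ∑ j ∈ s, b j w) 0 ρ := CircleIntegrable.fun_sum s hb
  have hc : CircleIntegrable (fun w => c • ∑ j ∈ s, b j w) 0 ρ := hs.const_smul (a := c)
  have hac : CircleIntegrable (fun w => a w + c • ∑ j ∈ s, b j w) 0 ρ := ha.add hc
  have := Real.circleAverage_mono_on_of_le_circle hac (a := M) fun w hw => by
    rw [abs_of_pos hρ] at hw
    exact h w hw
  rwa [Real.circleAverage_fun_add ha hc, Real.circleAverage_fun_smul,
    Real.circleAverage_fun_sum hb, smul_eq_mul] at this

/-- A function bounded by `M` on a polydisc of radius larger than `1` has square-summable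
increments along the coordinate vectors. The base point `y` may have non-zero coordinates outside
`s`, which is what the induction needs. The induction adds one coordinate at a time: the inequality
for the old coordinates, applied with the new coordinate on a circle of radius `ρ`, is averaged over
that circle. -/
theorem norm_sq_add_sum_norm_sq_le {ι : Type*} [Fintype ι] [DecidableEq ι] {g : (ι → ℂ) → ℂ}
    {ρ R M : ℝ} (hρ : 1 < ρ) (hR : ρ < R) (hg : DifferentiableOn ℂ g (ball 0 R))
    (hM : ∀ z ∈ ball 0 R, ‖g z‖ ≤ M) (s : Finset ι) :
    ∀ y ∈ ball (0 : ι → ℂ) R, (∀ j ∈ s, y j = 0) →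
      ‖g y‖ ^ 2 + (ρ - 1) / ρ * ∑ j ∈ s, ‖g (y + Pi.single j 1) - g y‖ ^ 2 ≤ M ^ 2 := by
  have h0 : 0 < ρ := one_pos.trans hρ
  have h1 : 0 < ρ - 1 := sub_pos.2 hρ
  have hRpos : 0 < R := h0.trans hR
  induction s using Finset.induction_on with
  | empty =>
    intro y hy _
    simpa using pow_le_pow_left₀ (norm_nonneg _) (hM y hy) 2
  | insert i s hi ih =>
    intro y hy hys
    have hyi : y i = 0 := hys i (Finset.mem_insert_self _ _)
    have hyR : ∀ j, ‖y j‖ < R := (pi_norm_lt_iff hRpos).1 (mem_ball_zero_iff.1 hy)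
    -- The slices in the direction of the new coordinate stay in the polydisc.
    have hball : ∀ v : ι → ℂ, v i = 0 → (∀ j, ‖v j‖ < R) → ∀ w : ℂ, ‖w‖ < R →
        v + Pi.single i w ∈ ball (0 : ι → ℂ) R := by
      intro v hvi hv w hw
      refine mem_ball_zero_iff.2 ((pi_norm_lt_iff hRpos).2 fun j => ?_)
      by_cases hj : j = i
      · subst hj; simpa [hvi] using hw
      · simpa [hj] using hv j
    have hslice : ∀ v : ι → ℂ, v i = 0 → (∀ j, ‖v j‖ < R) →
        DiffContOnCl ℂ (fun w : ℂ => g (v + Pi.single i w)) (ball 0 ρ) := by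
      intro v hvi hv
      have hd : Differentiable ℂ fun w : ℂ => v + Pi.single i w :=
        ((ContinuousLinearMap.single ℂ (fun _ : ι => ℂ) i).differentiable).const_add v
      refine DifferentiableOn.diffContOnCl ?_
      rw [closure_ball _ h0.ne']
      exact hg.comp hd.differentiableOn fun w hw =>
        hball v hvi hv w ((mem_closedBall_zero_iff.1 hw).trans_lt hR)
    have hys' : ∀ j ∈ s, ∀ k, ‖(y + Pi.single j 1 : ι → ℂ) k‖ < R := by
      intro j hj k
      by_cases hk : k = j
      · subst hk
        simpa [hys k (Finset.mem_insert_of_mem hj)] using hρ.trans hR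
      · simpa [hk] using hyR k
    have hne : ∀ j ∈ s, j ≠ i := fun j hj h => hi (h ▸ hj)
    have hyi' : ∀ j ∈ s, (y + Pi.single j 1 : ι → ℂ) i = 0 := by
      intro j hj
      simp [hyi, (hne j hj).symm]
    have hsphere : sphere (0 : ℂ) ρ ⊆ closure (ball 0 ρ) := by
      rw [closure_ball _ h0.ne']; exact sphere_subset_closedBall
    have hc0 := (hslice y hyi hyR).continuousOn.mono hsphere
    have hcd : ∀ j ∈ s, DiffContOnCl ℂ (fun w : ℂ => g (y + Pi.single j 1 + Pi.single i w) -
        g (y + Pi.single i w)) (ball 0 ρ) := fun j hj =>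
      (hslice _ (hyi' j hj) (hys' j hj)).sub (hslice y hyi hyR)
    have i1 : CircleIntegrable (fun w : ℂ => ‖g (y + Pi.single i w)‖ ^ 2) 0 ρ :=
      (hc0.norm.pow 2).circleIntegrable h0.le
    have i2 : ∀ j ∈ s, CircleIntegrable (fun w : ℂ => ‖g (y + Pi.single j 1 + Pi.single i w) -
        g (y + Pi.single i w)‖ ^ 2) 0 ρ := fun j hj =>
      (((hcd j hj).continuousOn.mono hsphere).norm.pow 2).circleIntegrable h0.le
    have hpt : ∀ w ∈ sphere (0 : ℂ) ρ, ‖g (y + Pi.single i w)‖ ^ 2 + (ρ - 1) / ρ * ∑ j ∈ s,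
        ‖g (y + Pi.single j 1 + Pi.single i w) - g (y + Pi.single i w)‖ ^ 2 ≤ M ^ 2 := by
      intro w hw
      rw [mem_sphere_zero_iff_norm] at hw
      have hp := hball y hyi hyR w (hw.le.trans_lt hR)
      have hp0 : ∀ j ∈ s, (y + Pi.single i w : ι → ℂ) j = 0 := fun j hj => by
        rw [Pi.add_apply, hys j (Finset.mem_insert_of_mem hj), Pi.single_eq_of_ne (hne j hj),
          add_zero]
      have := ih _ hp hp0
      simp only [add_right_comm y (Pi.single i w)] at this
      exact this
    have hadd := circleAverage_add_mul_sum_le (ι := ι)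
      (a := fun w : ℂ => ‖g (y + Pi.single i w)‖ ^ 2)
      (b := fun (j : ι) (w : ℂ) => ‖g (y + Pi.single j 1 + Pi.single i w) -
        g (y + Pi.single i w)‖ ^ 2) (c := (ρ - 1) / ρ) (M := M ^ 2) h0 s
    have havg := hadd i1 i2 hpt
    have e1 := norm_sq_add_le_circleAverage hρ (hslice y hyi hyR)
    have e2 : ∀ j ∈ s, ‖g (y + Pi.single j 1) - g y‖ ^ 2 ≤ Real.circleAverage
        (fun w : ℂ => ‖g (y + Pi.single j 1 + Pi.single i w) -
          g (y + Pi.single i w)‖ ^ 2) 0 ρ := by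
      intro j hj
      have := norm_sq_le_circleAverage (hcd j hj) (w := 0) (by simpa using h0)
      simpa [div_self h0.ne'] using this
    have e3 := mul_le_mul_of_nonneg_left (Finset.sum_le_sum e2) (div_pos h1 h0).le
    simp only [Pi.single_zero, add_zero] at e1
    rw [Finset.sum_insert hi, mul_add]
    linarith

/-! ### Null sequences -/

theorem CZero.norm_le_iff {x : CZero} {C : ℝ} (hC : 0 ≤ C) : ‖x‖ ≤ C ↔ ∀ i, ‖x i‖ ≤ C :=
  BoundedContinuousFunction.norm_le (f := x.toBCF) hC

/-- The `i`-th coordinate functional on `c₀`. -/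
noncomputable def CZero.coord (i : ℕ) : CZero →L[ℂ] ℂ :=
  LinearMap.mkContinuous
    { toFun := fun x => x i
      map_add' := fun _ _ => rfl
      map_smul' := fun _ _ => rfl } 1 fun x => by simpa using norm_apply_le x i

@[simp]
theorem CZero.coord_apply (i : ℕ) (x : CZero) : CZero.coord i x = x i := rfl

/-- The null sequence `(a 0, …, a (n - 1), 0, 0, …)`. -/
noncomputable def CZero.truncate (n : ℕ) (a : ℕ → ℂ) : CZero where
  toFun i := if i < n then a i else 0
  continuous_toFun := continuous_of_discreteTopology
  zero_at_infty' := by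
    rw [cocompact_eq_cofinite, Nat.cofinite_eq_atTop]
    refine tendsto_const_nhds.congr' ?_
    filter_upwards [eventually_ge_atTop n] with i hi
    simp [hi]

theorem CZero.truncate_apply (n : ℕ) (a : ℕ → ℂ) (i : ℕ) :
    CZero.truncate n a i = if i < n then a i else 0 := rfl

theorem CZero.norm_truncate_le {n : ℕ} {a : ℕ → ℂ} {C : ℝ} (hC : 0 ≤ C)
    (h : ∀ i < n, ‖a i‖ ≤ C) : ‖CZero.truncate n a‖ ≤ C := by
  refine (CZero.norm_le_iff hC).2 fun i => ?_
  rw [CZero.truncate_apply]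
  split_ifs with hi
  · exact h i hi
  · simpa using hC

theorem CZero.tendsto_truncate (x : CZero) :
    Tendsto (fun n => CZero.truncate n x) atTop (𝓝 x) := by
  have hx : Tendsto x atTop (𝓝 0) := by
    have h := x.zero_at_infty'
    rwa [cocompact_eq_cofinite, Nat.cofinite_eq_atTop] at h
  rw [Metric.tendsto_atTop]
  intro ε hε
  obtain ⟨n₀, hn₀⟩ := (Metric.tendsto_atTop.1 hx) (ε / 2) (half_pos hε)
  refine ⟨n₀, fun n hn => ?_⟩
  rw [dist_eq_norm]
  refine ((CZero.norm_le_iff (half_pos hε).le).2 fun i => ?_).trans_lt (half_lt_self hε)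
  change ‖CZero.truncate n x i - x i‖ ≤ ε / 2
  rw [CZero.truncate_apply]
  split_ifs with hi
  · simpa using (half_pos hε).le
  · have := hn₀ i (by omega)
    rw [dist_zero_right] at this
    simpa using this.le

/-- Disjointly supported vectors behave like the coordinate vectors of a polydisc. -/
theorem CZero.norm_sum_smul_le {N : ℕ} {v : ℕ → CZero} {r : ℝ} (hr : 0 ≤ r)
    (hv : ∀ j, ‖v j‖ ≤ r) (hdisj : ∀ i j l, j ≠ l → v j i ≠ 0 → v l i = 0)
    (z : Fin N → ℂ) : ‖∑ j, z j • v j‖ ≤ ‖z‖ * r := by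
  have hnn : 0 ≤ ‖z‖ * r := mul_nonneg (norm_nonneg z) hr
  refine (CZero.norm_le_iff hnn).2 fun i => ?_
  have e : (∑ j, z j • v j) i = ∑ j, z j * v j i := by
    rw [← CZero.coord_apply, map_sum]
    rfl
  rw [e]
  by_cases h : ∃ j : Fin N, v j i ≠ 0
  · obtain ⟨j, hj⟩ := h
    rw [Finset.sum_eq_single j]
    · rw [norm_mul]
      exact mul_le_mul (norm_le_pi_norm z j) ((norm_apply_le _ i).trans (hv j)) (norm_nonneg _)
        (norm_nonneg _)
    · intro l _ hl
      rw [hdisj i j l (fun h => hl (Fin.ext h).symm) hj, mul_zero]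
    · simp
  · push Not at h
    simpa [h] using hnn

/-! ### Holomorphic functions on the ball of `c₀` at vectors with late support -/

/-- If the conclusion failed there would be infinitely many disjointly supported vectors `v j` in
the ball of radius `r` with `|g (v j) - g 0|` bounded below, contradicting
`norm_sq_add_sum_norm_sq_le` for the functions `z ↦ g (∑ z j • v j)`, all of which have the same
bound on a polydisc of radius larger than `1`. -/
theorem exists_forall_support_norm_sub_lt {g : CZero → ℂ} (hg : DifferentiableOn ℂ g (ball 0 1))
    (hb : ∀ r < 1, ∃ M, ∀ x, ‖x‖ ≤ r → ‖g x‖ ≤ M) {r : ℝ} (hr : r < 1) {ε : ℝ} (hε : 0 < ε) :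
    ∃ k, ∀ x : CZero, ‖x‖ ≤ r → (∀ i < k, x i = 0) → ‖g x - g 0‖ < ε := by
  by_contra! hcon
  -- The vectors can be taken finitely supported.
  have hfin : ∀ k, ∃ (x : CZero) (n : ℕ), ‖x‖ ≤ r ∧ (∀ i < k, x i = 0) ∧ (∀ i ≥ n, x i = 0) ∧
      ε / 2 < ‖g x - g 0‖ := by
    intro k
    obtain ⟨x, hxr, hxk, hxε⟩ := hcon k
    have hx1 : x ∈ ball (0 : CZero) 1 := mem_ball_zero_iff.2 (hxr.trans_lt hr)
    have hcont : ContinuousAt g x := (hg.differentiableAt (isOpen_ball.mem_nhds hx1)).continuousAt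
    have hlim : Tendsto (fun n => ‖g (CZero.truncate n x) - g 0‖) atTop (𝓝 ‖g x - g 0‖) :=
      ((hcont.tendsto.comp (CZero.tendsto_truncate x)).sub_const (g 0)).norm
    obtain ⟨n, hn⟩ := (hlim.eventually_const_lt ((half_lt_self hε).trans_le hxε)).exists
    refine ⟨CZero.truncate n x, n, ?_, fun i hi => ?_, fun i hi => ?_, hn⟩
    · exact CZero.norm_truncate_le ((norm_nonneg x).trans hxr)
        fun i _ => (norm_apply_le x i).trans hxr
    · simp [CZero.truncate_apply, hxk i hi]
    · simp [CZero.truncate_apply, hi]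
  choose x n hxr hxk hxn hxε using hfin
  let K : ℕ → ℕ := fun j => Nat.rec 0 (fun _ m => max m (n m)) j
  have hKs : ∀ j, K (j + 1) = max (K j) (n (K j)) := fun _ => rfl
  have hK : Monotone K := monotone_nat_of_le_succ fun j => by rw [hKs]; exact le_max_left _ _
  let v : ℕ → CZero := fun j => x (K j)
  have hlt : ∀ i j l, j < l → v j i = 0 ∨ v l i = 0 := by
    intro i j l hjl
    rcases lt_or_ge i (n (K j)) with h | h
    · refine Or.inr (hxk _ i (h.trans_le ?_))
      exact (le_max_right (K j) _).trans ((hKs j).ge.trans (hK hjl))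
    · exact Or.inl (hxn _ i h)
  have hdisj : ∀ i j l, j ≠ l → v j i ≠ 0 → v l i = 0 := by
    intro i j l hne h
    rcases lt_or_gt_of_ne hne with h' | h'
    · exact (hlt i j l h').resolve_left h
    · exact (hlt i l j h').resolve_right h
  have hr0 : 0 ≤ r := (norm_nonneg _).trans (hxr 0)
  obtain ⟨R, hR1, hRr⟩ : ∃ R : ℝ, 1 < R ∧ R * r < 1 := by
    refine ⟨2 / (1 + r), ?_, ?_⟩
    · rw [lt_div_iff₀ (by positivity)]; linarith
    · rw [div_mul_eq_mul_div, div_lt_one (by positivity)]; linarith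
  obtain ⟨ρ, hρ, hρR⟩ := exists_between hR1
  obtain ⟨M, hM⟩ := hb (R * r) hRr
  have h0 : 0 < ρ := one_pos.trans hρ
  have h1 : 0 < ρ - 1 := sub_pos.2 hρ
  have hbound : ∀ N : ℕ, N * ((ρ - 1) / ρ * (ε / 2) ^ 2) ≤ M ^ 2 := by
    intro N
    have hnorm : ∀ z ∈ ball (0 : Fin N → ℂ) R, ‖∑ j, z j • v j‖ ≤ R * r := fun z hz =>
      (CZero.norm_sum_smul_le hr0 (fun j => hxr _) hdisj z).trans
        (mul_le_mul_of_nonneg_right (mem_ball_zero_iff.1 hz).le hr0)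
    have hd : Differentiable ℂ fun z : Fin N → ℂ => ∑ j, z j • v j := by fun_prop
    have key := norm_sq_add_sum_norm_sq_le (g := fun z : Fin N → ℂ => g (∑ j, z j • v j))
      hρ hρR (hg.comp hd.differentiableOn fun z hz =>
        mem_ball_zero_iff.2 ((hnorm z hz).trans_lt hRr)) (fun z hz => hM _ (hnorm z hz))
      Finset.univ 0 (mem_ball_self (h0.trans hρR)) (fun _ _ => rfl)
    have hsum : ∀ j : Fin N, ∑ l, (0 + Pi.single j 1 : Fin N → ℂ) l • v l = v j := by
      intro j
      rw [Finset.sum_eq_single j]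
      · simp
      · intro l _ hl
        simp [hl]
      · simp
    simp only [hsum, Pi.zero_apply, zero_smul, Finset.sum_const_zero] at key
    have hlow : (N : ℝ) * (ε / 2) ^ 2 ≤ ∑ j : Fin N, ‖g (v j) - g 0‖ ^ 2 := by
      have := Finset.card_nsmul_le_sum (Finset.univ : Finset (Fin N))
        (fun j => ‖g (v j) - g 0‖ ^ 2) ((ε / 2) ^ 2) fun j _ =>
          pow_le_pow_left₀ (half_pos hε).le (hxε _).le 2
      simpa using this
    have := mul_le_mul_of_nonneg_left hlow (div_pos h1 h0).le
    nlinarith [sq_nonneg ‖g 0‖]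
  obtain ⟨N, hN⟩ := exists_nat_gt (M ^ 2 / ((ρ - 1) / ρ * (ε / 2) ^ 2))
  rw [div_lt_iff₀ (by positivity)] at hN
  exact absurd (hbound N) hN.not_ge

/-! ### Convergence and point evaluation in `H_b` -/

/-- Evaluation of a function in `H_b(B_X)` at a point of the ball. -/
def Hb.eval {X : Type*} [NormedAddCommGroup X] [NormedSpace ℂ X] (x : UnitBall X) :
    Hb X →ₗ[ℂ] ℂ where
  toFun f := UniformOnFun.toFun _ f.1 x
  map_add' _ _ := rfl
  map_smul' _ _ := rfl

/-- The origin of the unit ball. -/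
def UnitBall.origin (X : Type*) [NormedAddCommGroup X] : UnitBall X :=
  ⟨0, mem_ball_self one_pos⟩

theorem Hb.tendsto_iff {X : Type*} [NormedAddCommGroup X] [NormedSpace ℂ X] {ι : Type*}
    {l : Filter ι} {F : ι → Hb X} {f : Hb X} :
    Tendsto F l (𝓝 f) ↔ ∀ r < 1, ∀ ε > 0, ∀ᶠ n in l, ∀ x : UnitBall X, ‖(x : X)‖ ≤ r →
      ‖Hb.eval x (F n) - Hb.eval x f‖ < ε := by
  rw [tendsto_subtype_rng, UniformOnFun.tendsto_iff_tendstoUniformlyOn]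
  constructor
  · intro h r hr ε hε
    have := Metric.tendstoUniformlyOn_iff.1
      (h {x | ‖(x : X)‖ ≤ r} ((isRelBounded_unitBall_iff _).2 ⟨r, hr, fun _ ha => ha⟩)) ε hε
    filter_upwards [this] with n hn x hx
    have := hn x hx
    rwa [dist_comm, dist_eq_norm] at this
  · intro h A hA
    obtain ⟨r, hr, hAr⟩ := (isRelBounded_unitBall_iff A).1 hA
    refine Metric.tendstoUniformlyOn_iff.2 fun ε hε => ?_
    filter_upwards [h r hr ε hε] with n hn x hx
    rw [dist_comm, dist_eq_norm]
    exact hn x (hAr x hx)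

theorem Hb.exists_norm_eval_le {X : Type*} [NormedAddCommGroup X] [NormedSpace ℂ X] (f : Hb X)
    {r : ℝ} (hr : r < 1) : ∃ M, ∀ x : UnitBall X, ‖(x : X)‖ ≤ r → ‖Hb.eval x f‖ ≤ M := by
  obtain ⟨M, hM⟩ := (f.2.2 {x | ‖(x : X)‖ ≤ r}
    ((isRelBounded_unitBall_iff _).2 ⟨r, hr, fun _ ha => ha⟩)).exists_norm_le
  exact ⟨M, fun x hx => hM _ ⟨x, hx, rfl⟩⟩

section Composition

variable {X : Type*} [NormedAddCommGroup X] [NormedSpace ℂ X] {φ : UnitBall X → UnitBall X}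
  (hφ : IsHolomorphic fun x => (φ x : X)) (hb : IsBoundedType φ)

theorem eval_compositionOperator (f : Hb X) (x : UnitBall X) :
    Hb.eval x (compositionOperator φ hφ hb f) = Hb.eval (φ x) f := rfl

theorem eval_compositionOperator_pow (k : ℕ) (f : Hb X) (x : UnitBall X) :
    Hb.eval x ((compositionOperator φ hφ hb ^ k) f) = Hb.eval (φ^[k] x) f := by
  induction k generalizing f with
  | zero => rfl
  | succ k ih =>
    rw [pow_succ, mul_apply_eq_comp, ih, eval_compositionOperator,
      Function.iterate_succ_apply']

theorem eval_cesaroMean_compositionOperator (n : ℕ) (f : Hb X) (x : UnitBall X) :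
    Hb.eval x (cesaroMean (compositionOperator φ hφ hb) n f) =
      (n : ℂ)⁻¹ * ∑ k ∈ Finset.range n, Hb.eval (φ^[k] x) f := by
  rw [cesaroMean, smul_apply, map_smul, smul_eq_mul, sum_apply, map_sum]
  simp only [eval_compositionOperator_pow]

end Composition

/-- With `isBoundedType_const_origin`, this makes `f ↦ f 0`, the limit of the Cesàro means, a
composition operator: that of the constant map to the origin. -/
theorem isHolomorphic_const_origin (X : Type*) [NormedAddCommGroup X] [NormedSpace ℂ X] :
    IsHolomorphic fun _ : UnitBall X => (UnitBall.origin X : X) :=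
  ⟨fun _ => 0, differentiableOn_const 0, fun _ => rfl⟩

theorem isBoundedType_const_origin (X : Type*) [NormedAddCommGroup X] [NormedSpace ℂ X] :
    IsBoundedType fun _ : UnitBall X => UnitBall.origin X := by
  intro A _
  refine (isRelBounded_unitBall_iff _).2 ⟨0, one_pos, ?_⟩
  rintro _ ⟨_, -, rfl⟩
  simp [UnitBall.origin]

/-! ### Iterates of the forward shift -/

theorem forwardShiftBall_iterate_apply (k : ℕ) (x : UnitBall CZero) (i : ℕ) :
    (forwardShiftBall^[k] x : CZero) i = if k ≤ i then (x : CZero) (i - k) else 0 := by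
  induction k generalizing i with
  | zero => simp
  | succ k ih =>
    rw [Function.iterate_succ_apply']
    cases i with
    | zero => rfl
    | succ i =>
      change (forwardShiftBall^[k] x : CZero) i = _
      rw [ih]
      simp

theorem norm_forwardShiftBall_iterate_le (k : ℕ) (x : UnitBall CZero) :
    ‖(forwardShiftBall^[k] x : CZero)‖ ≤ ‖(x : CZero)‖ := by
  refine (CZero.norm_le_iff (norm_nonneg _)).2 fun i => ?_
  rw [forwardShiftBall_iterate_apply]
  split_ifs
  · exact norm_apply_le _ _
  · simp

/-! ### Mean ergodicity -/

/-- The iterates `C_F ^ k f` converge to the constant `f 0`, since `F ^ k` maps a ball into the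
vectors of that ball which vanish in the first `k` coordinates. -/
theorem exists_forall_norm_eval_iterate_sub_lt (f : Hb CZero) {r : ℝ} (hr : r < 1) {ε : ℝ}
    (hε : 0 < ε) : ∃ k₀, ∀ k ≥ k₀, ∀ x : UnitBall CZero, ‖(x : CZero)‖ ≤ r →
      ‖Hb.eval (forwardShiftBall^[k] x) f - Hb.eval (UnitBall.origin CZero) f‖ < ε := by
  obtain ⟨g, hg, hgf'⟩ := f.2.1
  have hgf : ∀ x : UnitBall CZero, g x = Hb.eval x f := hgf'
  have hb : ∀ r < 1, ∃ M, ∀ x, ‖x‖ ≤ r → ‖g x‖ ≤ M := by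
    intro r hr
    obtain ⟨M, hM⟩ := Hb.exists_norm_eval_le f hr
    refine ⟨M, fun x hx => ?_⟩
    have := hM ⟨x, mem_ball_zero_iff.2 (hx.trans_lt hr)⟩ hx
    rwa [← hgf] at this
  obtain ⟨k₀, hk₀⟩ := exists_forall_support_norm_sub_lt hg hb hr hε
  refine ⟨k₀, fun k hk x hx => ?_⟩
  have := hk₀ (forwardShiftBall^[k] x) ((norm_forwardShiftBall_iterate_le k x).trans hx)
    fun i hi => by rw [forwardShiftBall_iterate_apply, if_neg (by omega)]
  have h0 : g 0 = Hb.eval (UnitBall.origin CZero) f := hgf (UnitBall.origin CZero)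
  rw [hgf, h0] at this
  exact this

/-- Cesàro means of a family of bounded sequences, all within `δ` of their limit from the index `k₀`
on, converge uniformly over the family. -/
theorem eventually_norm_average_sub_lt {k₀ : ℕ} {B δ ε : ℝ} (hδ : δ < ε) :
    ∀ᶠ n : ℕ in atTop, ∀ (a : ℕ → ℂ) (b : ℂ), (∀ k, ‖a k - b‖ ≤ B) →
      (∀ k ≥ k₀, ‖a k - b‖ ≤ δ) → ‖(n : ℂ)⁻¹ * ∑ k ∈ Finset.range n, a k - b‖ < ε := by
  let u : ℕ → ℝ := fun k => if k < k₀ then B else δ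
  have hu : Tendsto u atTop (𝓝 δ) := by
    refine tendsto_const_nhds.congr' ?_
    filter_upwards [eventually_ge_atTop k₀] with k hk
    simp [u, hk]
  filter_upwards [hu.cesaro.eventually_lt_const hδ, eventually_gt_atTop 0] with n hn hn0 a b hB hk₀
  have hn' : (n : ℂ) ≠ 0 := Nat.cast_ne_zero.2 hn0.ne'
  have e : (n : ℂ)⁻¹ * ∑ k ∈ Finset.range n, a k - b =
      (n : ℂ)⁻¹ * ∑ k ∈ Finset.range n, (a k - b) := by
    rw [Finset.sum_sub_distrib, mul_sub]
    simp [hn']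
  rw [e, norm_mul, norm_inv, Complex.norm_natCast]
  refine lt_of_le_of_lt ?_ hn
  gcongr
  refine norm_sum_le_of_le _ fun k _ => ?_
  by_cases h : k < k₀
  · simpa [u, h] using hB k
  · simpa [u, h] using hk₀ k (not_lt.1 h)

theorem tendsto_cesaroMean_forwardShift (f : Hb CZero) :
    Tendsto (fun n => cesaroMean (compositionOperator forwardShiftBall
      isHolomorphic_forwardShiftBall isBoundedType_forwardShiftBall) n f) atTop
      (𝓝 (compositionOperator _ (isHolomorphic_const_origin CZero)
        (isBoundedType_const_origin CZero) f)) := by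
  refine Hb.tendsto_iff.2 fun r hr ε hε => ?_
  obtain ⟨M, hM⟩ := Hb.exists_norm_eval_le f hr
  obtain ⟨k₀, hk₀⟩ := exists_forall_norm_eval_iterate_sub_lt f hr (half_pos hε)
  filter_upwards [eventually_norm_average_sub_lt (k₀ := k₀) (B := M + M) (half_lt_self hε)]
    with n hn x hx
  rw [eval_cesaroMean_compositionOperator, eval_compositionOperator]
  refine hn _ _ (fun k => ?_) fun k hk => (hk₀ k hk x hx).le
  refine (norm_sub_le _ _).trans (add_le_add
    (hM _ ((norm_forwardShiftBall_iterate_le k x).trans hx)) (hM _ ?_))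
  simpa [UnitBall.origin] using (norm_nonneg _).trans hx

/-! ### Failure of uniform mean ergodicity -/

/-- Uniform convergence on a bounded set, along a sequence of arguments that may vary with the index
of the mean. -/
theorem IsUniformlyMeanErgodic.exists_tendsto_sub {E : Type*} [AddCommGroup E] [Module ℂ E]
    [TopologicalSpace E] [IsTopologicalAddGroup E] [ContinuousSMul ℂ E] {T : E →L[ℂ] E}
    (hT : IsUniformlyMeanErgodic T) : ∃ L : E →L[ℂ] E,
      (∀ x, Tendsto (fun n => cesaroMean T n x) atTop (𝓝 (L x))) ∧
      ∀ S : Set E, IsVonNBounded ℂ S → ∀ x : ℕ → E, (∀ n, x n ∈ S) →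
        Tendsto (fun n => cesaroMean T n (x n) - L (x n)) atTop (𝓝 0) := by
  obtain ⟨L, hL⟩ := hT
  refine ⟨L, fun x => ((continuous_eval_const x).tendsto L).comp hL, fun S hS x hx => ?_⟩
  have h0 : Tendsto (fun n => cesaroMean T n - L) atTop (𝓝 0) := by
    simpa using hL.sub_const L
  refine tendsto_def.2 fun V hV => ?_
  filter_upwards [h0.eventually (ContinuousLinearMap.hasBasis_nhds_zero.mem_of_mem
    (i := (S, V)) ⟨hS, hV⟩)] with n hn
  exact hn (x n) (hx n)

/-- The `i`-th coordinate functional as an element of `H_b(B_{c₀})`. -/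
noncomputable def Hb.coord (i : ℕ) : Hb CZero :=
  ⟨UniformOnFun.ofFun _ fun x => (x : CZero) i,
    ⟨CZero.coord i, (CZero.coord i).differentiable.differentiableOn, fun _ => rfl⟩, by
      intro A _
      refine isBounded_iff_forall_norm_le.2 ⟨1, ?_⟩
      rintro _ ⟨x, -, rfl⟩
      exact (norm_apply_le _ i).trans (mem_ball_zero_iff.1 x.2).le⟩

theorem Hb.eval_coord (i : ℕ) (x : UnitBall CZero) : Hb.eval x (Hb.coord i) = (x : CZero) i := rfl

theorem Hb.isVonNBounded_range_coord : IsVonNBounded ℂ (Set.range Hb.coord) := by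
  refine isVonNBounded_of_smul_tendsto_zero (ε := fun n : ℕ => (1 / ((n : ℂ) + 1))) (l := atTop)
    (Eventually.of_forall fun n => one_div_ne_zero (Nat.cast_add_one_ne_zero n)) fun f hf => ?_
  refine Hb.tendsto_iff.2 fun r hr ε hε => ?_
  have h0 := (tendsto_one_div_add_atTop_nhds_zero_nat (𝕜 := ℂ)).norm
  rw [norm_zero] at h0
  filter_upwards [h0.eventually_lt_const hε] with n hn x hx
  obtain ⟨i, hi⟩ := hf n
  rw [map_zero, sub_zero, Pi.smul_apply', map_smul, ← hi, Hb.eval_coord, norm_smul]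
  refine (mul_le_of_le_one_right (norm_nonneg _) ?_).trans_lt hn
  exact (norm_apply_le _ i).trans (mem_ball_zero_iff.1 x.2).le

/-- The point `(1/2, …, 1/2, 0, 0, …)` of the ball of `c₀`, with `n` non-zero entries. -/
noncomputable def halfBlock (n : ℕ) : UnitBall CZero :=
  ⟨CZero.truncate n fun _ => 1 / 2, mem_ball_zero_iff.2 <|
    (CZero.norm_truncate_le (C := 1 / 2) (by norm_num) fun _ _ => by norm_num).trans_lt
      (by norm_num)⟩

theorem norm_halfBlock_le (n : ℕ) : ‖(halfBlock n : CZero)‖ ≤ 1 / 2 :=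
  CZero.norm_truncate_le (by norm_num) fun _ _ => by norm_num

/-- The first `n + 1` shifts move each of the entries `1/2` into the coordinate `n` exactly once. -/
theorem eval_cesaroMean_coord_halfBlock (n : ℕ) :
    Hb.eval (halfBlock (n + 1)) (cesaroMean (compositionOperator forwardShiftBall
      isHolomorphic_forwardShiftBall isBoundedType_forwardShiftBall) (n + 1) (Hb.coord n)) =
        1 / 2 := by
  rw [eval_cesaroMean_compositionOperator]
  have : ∀ k ∈ Finset.range (n + 1),
      Hb.eval (forwardShiftBall^[k] (halfBlock (n + 1))) (Hb.coord n) = 1 / 2 := by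
    intro k hk
    have hk' : k ≤ n := Nat.lt_succ_iff.1 (Finset.mem_range.1 hk)
    rw [Hb.eval_coord, forwardShiftBall_iterate_apply, if_pos hk', halfBlock,
      CZero.truncate_apply, if_pos (by omega)]
  rw [Finset.sum_congr rfl this, Finset.sum_const, Finset.card_range, nsmul_eq_mul, ← mul_assoc,
    inv_mul_cancel₀ (Nat.cast_ne_zero.2 n.succ_ne_zero), one_mul]

theorem not_isUniformlyMeanErgodic_forwardShift :
    ¬ IsUniformlyMeanErgodic (compositionOperator forwardShiftBall isHolomorphic_forwardShiftBall
      isBoundedType_forwardShiftBall) := by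
  intro hT
  obtain ⟨L, hL, hS⟩ := hT.exists_tendsto_sub
  -- The limit operator is determined by the pointwise limits.
  have hLf : ∀ (f : Hb CZero) (x : UnitBall CZero), Hb.eval x (L f) =
      Hb.eval (UnitBall.origin CZero) f := by
    have heval : ∀ x : UnitBall CZero, ∀ {F : ℕ → Hb CZero} {f : Hb CZero},
        Tendsto F atTop (𝓝 f) →
          Tendsto (fun n => Hb.eval x (F n)) atTop (𝓝 (Hb.eval x f)) := by
      intro x F f h
      refine Metric.tendsto_nhds.2 fun ε hε => ?_
      filter_upwards [Hb.tendsto_iff.1 h ‖(x : CZero)‖ (mem_ball_zero_iff.1 x.2) ε hε] with n hn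
      rw [dist_eq_norm]
      exact hn x le_rfl
    intro f x
    exact tendsto_nhds_unique (heval x (hL f)) (heval x (tendsto_cesaroMean_forwardShift f))
  -- The `n`-th coordinate is tested against the mean of order `n + 1`; the shifted index makes the
  -- sequence start at the mean of order `0`.
  have h := hS _ Hb.isVonNBounded_range_coord (fun n => Hb.coord (n - 1)) fun n => ⟨_, rfl⟩
  have h2 := (tendsto_add_atTop_iff_nat 1).2 h
  obtain ⟨n, hn⟩ := (Hb.tendsto_iff.1 h2 (1 / 2) (by norm_num) (1 / 2) (by norm_num)).exists
  have := hn (halfBlock (n + 1)) (norm_halfBlock_le _)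
  rw [Nat.add_sub_cancel, map_zero, sub_zero, map_sub, eval_cesaroMean_coord_halfBlock, hLf,
    Hb.eval_coord] at this
  norm_num [UnitBall.origin] at this

/-- The composition operator `C_F` of the forward shift `F` on `H_b(B_{c₀})` is mean ergodic but not
uniformly mean ergodic. -/
theorem mainTheorem7 :
    IsMeanErgodic (compositionOperator forwardShiftBall isHolomorphic_forwardShiftBall
      isBoundedType_forwardShiftBall) ∧
    ¬ IsUniformlyMeanErgodic (compositionOperator forwardShiftBall isHolomorphic_forwardShiftBall
      isBoundedType_forwardShiftBall) :=
  ⟨⟨_, tendsto_cesaroMean_forwardShift⟩, not_isUniformlyMeanErgodic_forwardShift⟩
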